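/- Let $1<p<\infty$ and let $p'=p/(p-1)$ be its conjugate exponent. Let $\mathrm{ces}(p)$ be the space of all complex sequences $x=(x_n)_{n\ge 1}$ with $$\|x\|_{\mathrm{ces}(p)}:=\Bigl(\sum_{n=1}^\infty\Bigl(\frac1n\sum_{k=1}^n|x_k|\Bigr)^p\Bigr)^{1/p}<\infty,$$ equipped with this norm and the coordinatewise order. Let $\mathcal L(\mathrm{ces}(p))$ be the algebra of all continuous linear operators on $\mathrm{ces}(p)$, and let $\mathcal L^r(\mathrm{ces}(p))$ be its subalgebra of regular operators, that is, of all finite complex linear combinations of positive operators (operators that map nonnegative sequences to nonnegative sequences). Let $C_{(p)}\in\mathcal L^r(\mathrm{ces}(p))$ be the Cesàro operator, $C_{(p)}x=\bigl(\frac1n\sum_{k=1}^n x_k\bigr)_{n\ge1}$, which is continuous and positive. Let $\sigma(C_{(p)})$ be the set of all $\lambda\in\mathbb C$ such that $\lambda I-C_{(p)}$ is not invertible in $\mathcal L(\mathrm{ces}(p))$, and let the order spectrum $\sigma_{\mathrm o}(C_{(p)})$ be the set of all $\lambda\in\mathbb C$ such that $\lambda I-C_{(p)}$ is not invertible in $\mathcal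 L^r(\mathrm{ces}(p))$. Then $$\sigma_{\mathrm o}(C_{(p)})=\sigma(C_{(p)})=\Bigl\{\lambda\in\mathbb C:\Bigl|\lambda-\frac{p'}2\Bigr|\le\frac{p'}2\Bigr\}.$$ -/

import Mathlib

open scoped ComplexOrder

noncomputable section

namespace CesaroSpace

/-! ### Regular operators and the order spectrum -/

section Regular

variable (E : Type*) [NormedAddCommGroup E] [NormedSpace ℂ E] [PartialOrder E]

/-- The positive operators: bounded linear operators mapping the positive cone into itself. -/
def positiveOperators : Set (E →L[ℂ] E) := {T | ∀ x : E, 0 ≤ x → 0 ≤ T x}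

/-- The algebra of regular operators on `E`: the finite complex linear combinations of positive
operators. -/
def regularOperators : Subalgebra ℂ (E →L[ℂ] E) :=
  (Submodule.span ℂ (positiveOperators E)).toSubalgebra
    (Submodule.subset_span fun _ hx => hx)
    (by
      intro S T hS hT
      have h := Submodule.mul_mem_mul hS hT
      rw [Submodule.span_mul_span] at h
      refine Submodule.span_mono ?_ h
      rintro _ ⟨A, hA, B, hB, rfl⟩ x hx
      exact hA _ (hB x hx))

theorem mem_regularOperators {T : E →L[ℂ] E} :
    T ∈ regularOperators E ↔ T ∈ Submodule.span ℂ (positiveOperators E) := Iff.rfl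

variable {E}

/-- The order spectrum of a regular operator: the set of `z : ℂ` such that `z I - T` is not
invertible in the algebra of regular operators. -/
def orderSpectrum (T : regularOperators E) : Set ℂ := spectrum ℂ T

end Regular

/-! ### The averaging map and Hardy's inequality -/

/-- The Cesàro averages `(C x)ₙ = (x₀ + ⋯ + xₙ) / (n + 1)` of a sequence. The index set
`{1, 2, 3, …}` of the sequences is represented by `ℕ` through the shift `n ↦ n + 1`. -/
def mean {𝕜 : Type*} [Field 𝕜] (x : ℕ → 𝕜) (n : ℕ) : 𝕜 :=
  (∑ k ∈ Finset.range (n + 1), x k) / ((n : 𝕜) + 1)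

theorem mean_nonneg {a : ℕ → ℝ} (ha : ∀ n, 0 ≤ a n) (n : ℕ) : 0 ≤ mean a n :=
  div_nonneg (Finset.sum_nonneg fun k _ => ha k) (by positivity)

theorem mean_mono {a b : ℕ → ℝ} (h : ∀ n, a n ≤ b n) (n : ℕ) : mean a n ≤ mean b n :=
  div_le_div_of_nonneg_right (Finset.sum_le_sum fun k _ => h k) (by positivity)

theorem norm_mean_le (x : ℕ → ℂ) (n : ℕ) : ‖mean x n‖ ≤ mean (fun k => ‖x k‖) n := by
  have h : ‖(n : ℂ) + 1‖ = (n : ℝ) + 1 := by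
    have := Complex.norm_natCast (n + 1)
    push_cast at this
    exact this
  unfold mean
  rw [norm_div, h]
  exact div_le_div_of_nonneg_right (norm_sum_le _ _) (by positivity)

theorem mean_add {𝕜 : Type*} [Field 𝕜] (x y : ℕ → 𝕜) (n : ℕ) :
    mean (fun k => x k + y k) n = mean x n + mean y n := by
  simp only [mean, Finset.sum_add_distrib, add_div]

theorem mean_mul {𝕜 : Type*} [Field 𝕜] (c : 𝕜) (x : ℕ → 𝕜) (n : ℕ) :
    mean (fun k => c * x k) n = c * mean x n := by
  simp only [mean, ← Finset.mul_sum, mul_div_assoc]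

theorem hardy_aux {p q : ℝ} (hpq : p.HolderConjugate q) {a : ℕ → ℝ} (ha : ∀ n, 0 ≤ a n)
    (N : ℕ) :
    ∑ n ∈ Finset.range (N + 1), mean a n ^ p + (q - 1) * ((N : ℝ) + 1) * mean a N ^ p ≤
      q * ∑ n ∈ Finset.range (N + 1), mean a n ^ (p - 1) * a n := by
  have hp := hpq.lt
  have hpow : ∀ t : ℝ, 0 ≤ t → t ^ (p - 1) * t = t ^ p := fun t ht => by
    rw [← Real.rpow_add_one' ht (by linarith), sub_add_cancel]
  induction N with
  | zero =>
    have h0 : mean a 0 = a 0 := by simp [mean]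
    simp only [zero_add, Finset.range_one, Finset.sum_singleton, h0, hpow _ (ha 0)]
    push_cast
    linarith
  | succ N ih =>
    rw [Finset.sum_range_succ, Finset.sum_range_succ (fun n => mean a n ^ (p - 1) * a n)]
    have hA := mean_nonneg ha (N + 1)
    have hB := mean_nonneg ha N
    have hrec : a (N + 1) = ((N : ℝ) + 2) * mean a (N + 1) - ((N : ℝ) + 1) * mean a N := by
      have e1 : ((N : ℝ) + 2) ≠ 0 := by positivity
      have e2 : ((N : ℝ) + 1) ≠ 0 := by positivity
      have e3 : ((N : ℝ) + 1 + 1) ≠ 0 := by positivity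
      simp only [mean]
      rw [Finset.sum_range_succ _ (N + 1)]
      push_cast
      field_simp
      ring
    set A := mean a (N + 1)
    set B := mean a N
    have hY := Real.young_inequality_of_nonneg hB (Real.rpow_nonneg hA (p - 1)) hpq
    have hAq : (A ^ (p - 1)) ^ q = A ^ p := by
      rw [← Real.rpow_mul hA, hpq.sub_one_mul_conj]
    rw [hAq] at hY
    have hq0 := hpq.symm.pos
    have hqp : q / p = q - 1 := by
      have := hpq.symm.sub_one_mul_conj
      have hp0 := hpq.ne_zero
      field_simp
      linarith
    have hY2 : q * (B * A ^ (p - 1)) ≤ (q - 1) * B ^ p + A ^ p := by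
      have := mul_le_mul_of_nonneg_left hY hq0.le
      have e : q * (B ^ p / p + A ^ p / q) = (q / p) * B ^ p + A ^ p := by
        field_simp
      rwa [e, hqp] at this
    have hY3 := mul_le_mul_of_nonneg_left hY2 (by positivity : (0 : ℝ) ≤ (N : ℝ) + 1)
    rw [hrec]
    have e : A ^ (p - 1) * (((N : ℝ) + 2) * A - ((N : ℝ) + 1) * B) =
        ((N : ℝ) + 2) * A ^ p - ((N : ℝ) + 1) * (B * A ^ (p - 1)) := by
      rw [← hpow A hA]; ring
    rw [e]
    push_cast
    nlinarith [hY3, ih]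

theorem hardy_sum {p q : ℝ} (hpq : p.HolderConjugate q) {a : ℕ → ℝ} (ha : ∀ n, 0 ≤ a n)
    (N : ℕ) :
    ∑ n ∈ Finset.range N, mean a n ^ p ≤ q ^ p * ∑ n ∈ Finset.range N, a n ^ p := by
  rcases N with _ | N
  · simp
  set S := ∑ n ∈ Finset.range (N + 1), mean a n ^ p with hS
  set T := ∑ n ∈ Finset.range (N + 1), a n ^ p with hT
  have hq := hpq.symm.pos
  have hS0 : 0 ≤ S := Finset.sum_nonneg fun n _ => Real.rpow_nonneg (mean_nonneg ha n) _
  have hT0 : 0 ≤ T := Finset.sum_nonneg fun n _ => Real.rpow_nonneg (ha n) _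
  have h1 : S ≤ q * ∑ n ∈ Finset.range (N + 1), mean a n ^ (p - 1) * a n := by
    have h := hardy_aux hpq ha N
    have : 0 ≤ (q - 1) * ((N : ℝ) + 1) * mean a N ^ p :=
      mul_nonneg (mul_nonneg (by linarith [hpq.symm.lt]) (by positivity))
        (Real.rpow_nonneg (mean_nonneg ha N) _)
    linarith
  have h2 := Real.inner_le_Lp_mul_Lq_of_nonneg (Finset.range (N + 1))
    (f := fun n => mean a n ^ (p - 1)) (g := a) hpq.symm
    (fun n _ => Real.rpow_nonneg (mean_nonneg ha n) _) (fun n _ => ha n)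
  have h3 : ∀ n, (mean a n ^ (p - 1)) ^ q = mean a n ^ p := fun n => by
    rw [← Real.rpow_mul (mean_nonneg ha n), hpq.sub_one_mul_conj]
  simp only [h3] at h2
  rw [← hS, ← hT] at h2
  rcases hS0.eq_or_lt with h | hpos
  · rw [← h]; positivity
  have h4 : S ≤ q * (S ^ (1 / q) * T ^ (1 / p)) :=
    h1.trans (mul_le_mul_of_nonneg_left h2 hq.le)
  have h5 : S = S ^ (1 / q) * S ^ (1 / p) := by
    rw [← Real.rpow_add hpos, one_div, one_div, hpq.symm.inv_add_inv_eq_one, Real.rpow_one]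
  have h6 : S ^ (1 / p) ≤ q * T ^ (1 / p) := by
    refine le_of_mul_le_mul_left ?_ (Real.rpow_pos_of_pos hpos (1 / q))
    rw [← h5]
    linarith
  have h7 := Real.rpow_le_rpow (Real.rpow_nonneg hS0 _) h6 hpq.nonneg
  rwa [Real.mul_rpow hq.le (Real.rpow_nonneg hT0 _), ← Real.rpow_mul hS0, ← Real.rpow_mul hT0,
    one_div, inv_mul_cancel₀ hpq.ne_zero, Real.rpow_one, Real.rpow_one] at h7

theorem hardy_tsum {p q : ℝ} (hpq : p.HolderConjugate q) {a : ℕ → ℝ} (ha : ∀ n, 0 ≤ a n)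
    (hs : Summable fun n => a n ^ p) :
    (Summable fun n => mean a n ^ p) ∧ ∑' n, mean a n ^ p ≤ q ^ p * ∑' n, a n ^ p := by
  have hb : ∀ N, ∑ n ∈ Finset.range N, mean a n ^ p ≤ q ^ p * ∑' n, a n ^ p := fun N =>
    (hardy_sum hpq ha N).trans (mul_le_mul_of_nonneg_left
      (hs.sum_le_tsum _ fun n _ => Real.rpow_nonneg (ha n) _)
      (Real.rpow_nonneg hpq.symm.pos.le _))
  have h0 : ∀ n, 0 ≤ mean a n ^ p := fun n => Real.rpow_nonneg (mean_nonneg ha n) _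
  exact ⟨summable_of_sum_range_le h0 hb, Real.tsum_le_of_sum_range_le h0 hb⟩

/-! ### The discrete Cesàro space -/

section Ces

variable (p : ℝ)

/-- Membership in `ces(p)`: the series `∑ₙ (1/n ∑_{k ≤ n} |xₖ|)^p` converges. -/
def MemCes (x : ℕ → ℂ) : Prop := Summable fun n => mean (fun k => ‖x k‖) n ^ p

/-- The norm `(∑ₙ (1/n ∑_{k ≤ n} |xₖ|)^p)^(1/p)` of `ces(p)`. -/
def cesNorm (x : ℕ → ℂ) : ℝ := (∑' n, mean (fun k => ‖x k‖) n ^ p) ^ (1 / p)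

theorem mean_norm_nonneg (x : ℕ → ℂ) (n : ℕ) : 0 ≤ mean (fun k => ‖x k‖) n :=
  mean_nonneg (fun _ => norm_nonneg _) n

variable {p}

theorem MemCes.of_le (hp : 1 < p) {x : ℕ → ℂ} {b : ℕ → ℝ}
    (h : ∀ n, mean (fun k => ‖x k‖) n ≤ b n) (hb : Summable fun n => b n ^ p) :
    MemCes p x ∧ cesNorm p x ≤ (∑' n, b n ^ p) ^ (1 / p) := by
  have h1 : ∀ n, mean (fun k => ‖x k‖) n ^ p ≤ b n ^ p := fun n =>
    Real.rpow_le_rpow (mean_norm_nonneg x n) (h n) (by linarith)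
  have h0 : ∀ n, 0 ≤ mean (fun k => ‖x k‖) n ^ p := fun n =>
    Real.rpow_nonneg (mean_norm_nonneg x n) _
  have hs : MemCes p x := Summable.of_nonneg_of_le h0 h1 hb
  exact ⟨hs, Real.rpow_le_rpow (tsum_nonneg h0) (Summable.tsum_le_tsum h1 hs hb)
    (by positivity)⟩

theorem memCes_add (hp : 1 < p) {x y : ℕ → ℂ} (hx : MemCes p x) (hy : MemCes p y) :
    MemCes p (x + y) ∧ cesNorm p (x + y) ≤ cesNorm p x + cesNorm p y := by
  have h := Real.Lp_add_le_tsum_of_nonneg hp.le (mean_norm_nonneg x) (mean_norm_nonneg y) hx hy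
  have hle : ∀ n, mean (fun k => ‖(x + y) k‖) n ≤
      mean (fun k => ‖x k‖) n + mean (fun k => ‖y k‖) n := fun n => by
    rw [← mean_add]
    exact mean_mono (fun k => norm_add_le _ _) n
  have h' := MemCes.of_le hp hle h.1
  exact ⟨h'.1, h'.2.trans h.2⟩

theorem memCes_smul (hp : 1 < p) (c : ℂ) {x : ℕ → ℂ} (hx : MemCes p x) :
    MemCes p (c • x) ∧ cesNorm p (c • x) = ‖c‖ * cesNorm p x := by
  have h : ∀ n, mean (fun k => ‖(c • x) k‖) n ^ p =
      ‖c‖ ^ p * mean (fun k => ‖x k‖) n ^ p := fun n => by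
    simp only [Pi.smul_apply, smul_eq_mul, norm_mul, mean_mul]
    rw [Real.mul_rpow (norm_nonneg _) (mean_norm_nonneg x n)]
  refine ⟨?_, ?_⟩
  · unfold MemCes
    simp only [h]
    exact hx.mul_left _
  · unfold cesNorm
    simp only [h]
    rw [tsum_mul_left, Real.mul_rpow (by positivity)
      (tsum_nonneg fun n => Real.rpow_nonneg (mean_norm_nonneg x n) _),
      ← Real.rpow_mul (norm_nonneg _), mul_one_div_cancel (by linarith), Real.rpow_one]

theorem memCes_zero (hp : 1 < p) : MemCes p 0 ∧ cesNorm p 0 = 0 := by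
  have hp0 : p ≠ 0 := by linarith
  simp [MemCes, cesNorm, mean, Real.zero_rpow hp0, Real.zero_rpow (inv_ne_zero hp0)]

theorem eq_zero_of_cesNorm (hp : 1 < p) {x : ℕ → ℂ} (hx : MemCes p x) (h : cesNorm p x = 0) :
    x = 0 := by
  have hp0 : p ≠ 0 := by linarith
  have h0 : ∀ n, 0 ≤ mean (fun k => ‖x k‖) n ^ p := fun n =>
    Real.rpow_nonneg (mean_norm_nonneg x n) _
  have h1 : ∑' n, mean (fun k => ‖x k‖) n ^ p = 0 :=
    ((Real.rpow_eq_zero (tsum_nonneg h0) (by positivity)).1 h)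
  have h2 := (Summable.hasSum_iff hx).2 h1
  have h3 := (hasSum_zero_iff_of_nonneg h0).1 h2
  funext n
  have h4 : mean (fun k => ‖x k‖) n = 0 :=
    (Real.rpow_eq_zero (mean_norm_nonneg x n) hp0).1 (congrFun h3 n)
  have h5 : ∑ k ∈ Finset.range (n + 1), ‖x k‖ = 0 := by
    rcases div_eq_zero_iff.1 h4 with h5 | h5
    · exact h5
    · exact absurd h5 (by positivity)
  have h6 := (Finset.sum_eq_zero_iff_of_nonneg fun k _ => norm_nonneg (x k)).1 h5 n
    (Finset.self_mem_range_succ n)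
  exact norm_eq_zero.1 h6

theorem memCes_mean (hp : 1 < p) {x : ℕ → ℂ} (hx : MemCes p x) :
    MemCes p (mean x) ∧ cesNorm p (mean x) ≤ (p / (p - 1)) * cesNorm p x := by
  have hpq : p.HolderConjugate (p / (p - 1)) := Real.HolderConjugate.conjExponent hp
  have hH := hardy_tsum hpq (mean_norm_nonneg x) hx
  have h := MemCes.of_le hp (x := mean x) (fun n => mean_mono (fun k => norm_mean_le x k) n) hH.1
  refine ⟨h.1, h.2.trans ?_⟩
  have h0 : ∀ n, 0 ≤ mean (fun k => ‖x k‖) n ^ p := fun n =>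
    Real.rpow_nonneg (mean_norm_nonneg x n) _
  have hq := hpq.symm.pos
  have h1 := Real.rpow_le_rpow
    (tsum_nonneg fun n => Real.rpow_nonneg (mean_nonneg (mean_norm_nonneg x) n) _) hH.2
    (by positivity : 0 ≤ 1 / p)
  rwa [Real.mul_rpow (by positivity) (tsum_nonneg h0), ← Real.rpow_mul hq.le,
    mul_one_div_cancel hpq.ne_zero, Real.rpow_one] at h1

variable (p) [hp : Fact (1 < p)]

/-- `ces(p)` as a linear subspace of the space of all complex sequences. -/
def cesSubmodule : Submodule ℂ (ℕ → ℂ) where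
  carrier := {x | MemCes p x}
  add_mem' hx hy := (memCes_add hp.out hx hy).1
  zero_mem' := (memCes_zero hp.out).1
  smul_mem' c _ hx := (memCes_smul hp.out c hx).1

/-- The discrete Cesàro space `ces(p)`. It is a type of its own, so that it carries the topology of
its norm and not that of pointwise convergence. -/
def Ces : Type := cesSubmodule p

instance : AddCommGroup (Ces p) := inferInstanceAs (AddCommGroup (cesSubmodule p))

instance : Module ℂ (Ces p) := inferInstanceAs (Module ℂ (cesSubmodule p))

instance : CoeFun (Ces p) (fun _ => ℕ → ℂ) := ⟨Subtype.val⟩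

instance : NormedAddCommGroup (Ces p) :=
  AddGroupNorm.toNormedAddCommGroup
    { toFun := fun x : Ces p => cesNorm p (x : ℕ → ℂ)
      map_zero' := (memCes_zero hp.out).2
      add_le' := fun x y => (memCes_add hp.out x.2 y.2).2
      neg' := fun x => by
        have h := (memCes_smul hp.out (-1) x.2).2
        simp only [neg_smul, one_smul, norm_neg, norm_one, one_mul] at h
        exact h
      eq_zero_of_map_eq_zero' := fun x h =>
        Subtype.ext (eq_zero_of_cesNorm hp.out x.2 h) }

theorem norm_def (x : Ces p) :
    ‖x‖ = (∑' n, mean (fun k => ‖x k‖) n ^ p) ^ (1 / p) := rfl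

instance : NormedSpace ℂ (Ces p) where
  norm_smul_le c x := (memCes_smul hp.out c x.2).2.le

/-- The coordinatewise order of `ces(p)`. -/
instance : PartialOrder (Ces p) := PartialOrder.lift (fun x : Ces p => (x : ℕ → ℂ))
  Subtype.val_injective

/-- A sequence is positive if and only if all its terms are nonnegative real numbers. -/
theorem nonneg_iff (x : Ces p) : 0 ≤ x ↔ ∀ n, 0 ≤ (x n).re ∧ (x n).im = 0 := by
  have h : 0 ≤ x ↔ ∀ n, (0 : ℂ) ≤ x n := Iff.rfl
  simp only [h, Complex.nonneg_iff, eq_comm (a := (0 : ℝ)) (b := Complex.im _)]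

/-! ### The Cesàro operator -/

/-- The Cesàro operator `C₍ₚ₎`, a bounded linear operator on `ces(p)`. -/
def cesaroOperator : Ces p →L[ℂ] Ces p :=
  LinearMap.mkContinuous
    { toFun := fun x => (⟨mean x, (memCes_mean hp.out x.2).1⟩ : cesSubmodule p)
      map_add' := fun x y => Subtype.ext (funext fun n => mean_add x y n)
      map_smul' := fun c x => Subtype.ext (funext fun n => mean_mul c x n) }
    (p / (p - 1)) (fun x => (memCes_mean hp.out x.2).2)

theorem cesaroOperator_apply (x : Ces p) (n : ℕ) :
    cesaroOperator p x n = (∑ k ∈ Finset.range (n + 1), x k) / ((n : ℂ) + 1) := rfl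

theorem cesaroOperator_mem_positiveOperators : cesaroOperator p ∈ positiveOperators (Ces p) := by
  intro x hx n
  have hx' : ∀ n, (0 : ℂ) ≤ x n := hx
  change (0 : ℂ) ≤ (∑ k ∈ Finset.range (n + 1), x k) / ((n : ℂ) + 1)
  exact div_nonneg (Finset.sum_nonneg fun k _ => hx' k) (by exact_mod_cast (n + 1).zero_le)

/-- The Cesàro operator as an element of the algebra of regular operators on `ces(p)`. -/
def regularCesaroOperator : regularOperators (Ces p) :=
  ⟨cesaroOperator p, Submodule.subset_span (cesaroOperator_mem_positiveOperators p)⟩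

end Ces

end CesaroSpace

end

namespace CesaroSpace

/-! ### Kernels on the Cesàro averages -/

/-! Write `q = p / (p - 1)` for the conjugate exponent, `C` for the Cesàro operator and `w = 1/z`.
An inverse in the regular operators is an inverse in all bounded operators, so two facts suffice:
off the closed disc `z - C` has a regular inverse, and on the disc it has no bounded inverse.
Inversion turns the exterior of the disc into the half-plane `Re w < 1/q` and the open disc into `Re
w > 1/q`.

Outside the disc, `x - w C x = y` is a first-order recursion for the partial sums of `x`. Its
solution is `x = y + w K y`, with `K` lower triangular and given by `resolventKernel w`. For `a =
max (Re w) 0` this kernel is dominated by the nonnegative kernel of `a` (`norm_resolventKernel_le`).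
The latter is bounded because `s = K_a x` satisfies `s = C x + a C s`: Minkowski and Hardy give `‖s‖
≤ ‖C x‖ + a q ‖s‖` in `ℓ^p`, and `a q < 1` (`kernelMean_sum_le`). Domination also makes `K` regular.

For `μ` in the open disc, the products `P n = cesProd μ⁻¹ n` lie in `ℓ^q`, and `φ x = ∑ P n * mean x
n` is a nonzero bounded functional with `φ ∘ C = μ φ` (`exists_eigenfunctional`). If `z - C` had a
right inverse `R`, then `φ = (z - μ) φ ∘ R`, which is impossible for `μ` close to `z`. This reaches
the boundary circle, including `0`, without a closedness argument. -/

/-- The partial products `∏_{k < n} (1 - z / (k + 1))`. -/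
def cesProd {𝕜 : Type*} [Field 𝕜] (z : 𝕜) (n : ℕ) : 𝕜 :=
  ∏ k ∈ Finset.range n, (1 - z / ((k : 𝕜) + 1))

/-- The averages `(∑_{m ≤ n} h n m * x m) / (n + 1)` of a sequence, weighted by a kernel `h`. -/
def kernelMean {𝕜 : Type*} [Field 𝕜] (h : ℕ → ℕ → 𝕜) (x : ℕ → 𝕜) (n : ℕ) : 𝕜 :=
  (∑ m ∈ Finset.range (n + 1), h n m * x m) / ((n : 𝕜) + 1)

/-- The kernel `∏_{m ≤ k ≤ n} (1 - z / (k + 1))⁻¹` of the resolvent of the Cesàro operator. -/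
def resolventKernel {𝕜 : Type*} [Field 𝕜] (z : 𝕜) (n m : ℕ) : 𝕜 :=
  cesProd z m / cesProd z (n + 1)

section Field

variable {𝕜 : Type*} [Field 𝕜]

theorem cesProd_succ (z : 𝕜) (n : ℕ) :
    cesProd z (n + 1) = cesProd z n * (1 - z / ((n : 𝕜) + 1)) := Finset.prod_range_succ _ _

theorem cesProd_ne_zero {z : 𝕜} (hz : ∀ k : ℕ, 1 - z / ((k : 𝕜) + 1) ≠ 0) (n : ℕ) :
    cesProd z n ≠ 0 := Finset.prod_ne_zero_iff.2 fun k _ => hz k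

/-- Passing from row `n` to row `n + 1` divides the kernel by the new factor, and the new diagonal
entry is the inverse of that factor. With the initial value below, this recursion determines the
sums and drives both inductions that follow. -/
theorem sum_resolventKernel_succ {z : 𝕜} (hz : ∀ k : ℕ, 1 - z / ((k : 𝕜) + 1) ≠ 0)
    (y : ℕ → 𝕜) (n : ℕ) :
    (1 - z / (((n + 1 : ℕ) : 𝕜) + 1)) *
        ∑ m ∈ Finset.range (n + 1 + 1), resolventKernel z (n + 1) m * y m =
      ∑ m ∈ Finset.range (n + 1), resolventKernel z n m * y m + y (n + 1) := by
  have h1 := cesProd_ne_zero hz (n + 1)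
  have h2 := hz (n + 1)
  rw [Finset.sum_range_succ, mul_add, Finset.mul_sum]
  congr 1
  · refine Finset.sum_congr rfl fun m _ => ?_
    simp only [resolventKernel, cesProd_succ z (n + 1)]
    field_simp
  · simp only [resolventKernel, cesProd_succ z (n + 1)]
    field_simp

theorem sum_resolventKernel_zero {z : 𝕜} (hz : ∀ k : ℕ, 1 - z / ((k : 𝕜) + 1) ≠ 0)
    (y : ℕ → 𝕜) :
    (1 - z) * ∑ m ∈ Finset.range (0 + 1), resolventKernel z 0 m * y m = y 0 := by
  have := hz 0
  simp only [Nat.cast_zero, zero_add, div_one] at this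
  simp [resolventKernel, cesProd]
  field_simp

/-- The sequence `y + z * kernelMean (resolventKernel z) y` solves `x - z * mean x = y`. -/
theorem mean_resolvent {z : 𝕜} (hz : ∀ k : ℕ, 1 - z / ((k : 𝕜) + 1) ≠ 0) (y : ℕ → 𝕜) (n : ℕ) :
    mean (fun k => y k + z * kernelMean (resolventKernel z) y k) n =
      kernelMean (resolventKernel z) y n := by
  unfold mean
  rw [kernelMean]
  congr 1
  induction n with
  | zero =>
    have h := sum_resolventKernel_zero hz y
    simp only [kernelMean, zero_add, Finset.sum_range_one, Nat.cast_zero, div_one] at h ⊢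
    linear_combination -h
  | succ n ih =>
    have h := sum_resolventKernel_succ hz y n
    rw [Finset.sum_range_succ, ih, kernelMean]
    linear_combination -h

/-- The kernel of the resolvent sends `x - z * mean x` to `mean x`. -/
theorem kernelMean_resolventKernel_sub {z : 𝕜} (hz : ∀ k : ℕ, 1 - z / ((k : 𝕜) + 1) ≠ 0)
    (x : ℕ → 𝕜) (n : ℕ) :
    kernelMean (resolventKernel z) (fun k => x k - z * mean x k) n = mean x n := by
  unfold kernelMean
  rw [mean]
  congr 1
  induction n with
  | zero =>
    have h := sum_resolventKernel_zero hz (fun k => x k - z * mean x k)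
    have h0 := hz 0
    simp only [Nat.cast_zero, zero_add, div_one] at h0
    refine mul_left_cancel₀ h0 (h.trans ?_)
    simp [mean]
    ring
  | succ n ih =>
    have h := sum_resolventKernel_succ hz (fun k => x k - z * mean x k) n
    -- The partial sums of `x` satisfy the same recursion; its leading factor is nonzero and
    -- cancels.
    refine mul_left_cancel₀ (hz (n + 1)) (h.trans ?_)
    rw [ih, mean, Finset.sum_range_succ x (n + 1)]
    ring

end Field

/-! ### Comparison with the resolvent at a real point -/

theorem one_sub_div_pos {a : ℝ} (ha : a < 1) (ha0 : 0 ≤ a) (k : ℕ) :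
    0 < 1 - a / ((k : ℝ) + 1) := by
  have : a / ((k : ℝ) + 1) ≤ a := div_le_self ha0 (by linarith [k.cast_nonneg (α := ℝ)])
  linarith

theorem cesProd_pos {a : ℝ} (ha : a < 1) (ha0 : 0 ≤ a) (n : ℕ) : 0 < cesProd a n :=
  Finset.prod_pos fun k _ => one_sub_div_pos ha ha0 k

theorem one_sub_div_le_norm {a : ℝ} {z : ℂ} (hz : z.re ≤ a) (k : ℕ) :
    1 - a / ((k : ℝ) + 1) ≤ ‖1 - z / ((k : ℂ) + 1)‖ := by
  refine le_trans ?_ (Complex.re_le_norm _)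
  have e : (z / ((k : ℂ) + 1)).re = z.re / ((k : ℝ) + 1) := by
    have := Complex.div_natCast_re z (k + 1)
    push_cast at this
    exact this
  rw [Complex.sub_re, Complex.one_re, e]
  gcongr

theorem norm_resolventKernel_le {a : ℝ} (ha : a < 1) (ha0 : 0 ≤ a) {z : ℂ} (hz : z.re ≤ a)
    {n m : ℕ} (hmn : m ≤ n) : ‖resolventKernel z n m‖ ≤ resolventKernel a n m := by
  have hpos := fun n => cesProd_pos ha ha0 n
  have hne : ∀ k, 0 < ‖cesProd z k‖ := fun k => norm_pos_iff.2 <| cesProd_ne_zero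
    (fun k => norm_pos_iff.1 ((one_sub_div_pos ha ha0 k).trans_le (one_sub_div_le_norm hz k))) k
  rw [resolventKernel, resolventKernel, norm_div,
    div_le_div_iff₀ (hne _) (hpos _), mul_comm, mul_comm (cesProd a m)]
  -- Each factor of `cesProd z` is in norm at least the corresponding factor of `cesProd a`, so the
  -- quotient grows; the claim compares its values at `m` and `n + 1`.
  have key : Monotone fun k => ‖cesProd z k‖ / cesProd a k := by
    refine monotone_nat_of_le_succ fun k => ?_
    rw [div_le_div_iff₀ (hpos _) (hpos _), cesProd_succ, cesProd_succ, norm_mul]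
    have := mul_le_mul_of_nonneg_left (one_sub_div_le_norm hz k)
      (mul_nonneg (norm_nonneg (cesProd z k)) (hpos k).le)
    linarith
  have := key (hmn.trans n.le_succ)
  rw [div_le_div_iff₀ (hpos _) (hpos _)] at this
  linarith

theorem kernelMean_resolventKernel_nonneg {a : ℝ} (ha : a < 1) (ha0 : 0 ≤ a) {x : ℕ → ℝ}
    (hx : ∀ n, 0 ≤ x n) (n : ℕ) : 0 ≤ kernelMean (resolventKernel a) x n :=
  div_nonneg (Finset.sum_nonneg fun m _ => mul_nonneg
    (div_nonneg (cesProd_pos ha ha0 m).le (cesProd_pos ha ha0 _).le) (hx m)) (by positivity)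

/-- The estimate is made on finite sums, so that the norm of `s` is known to be finite and can be
absorbed into the left-hand side. -/
theorem kernelMean_sum_le {p q a : ℝ} (hpq : p.HolderConjugate q) (ha0 : 0 ≤ a) (haq : a * q < 1)
    {x : ℕ → ℝ} (hx : ∀ n, 0 ≤ x n) (N : ℕ) :
    (∑ n ∈ Finset.range N, kernelMean (resolventKernel a) x n ^ p) ^ (1 / p) ≤
      (1 - a * q)⁻¹ * (∑ n ∈ Finset.range N, mean x n ^ p) ^ (1 / p) := by
  have hq := hpq.symm.lt
  have ha : a < 1 := by nlinarith
  set s := kernelMean (resolventKernel a) x with hs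
  have hs0 : ∀ n, 0 ≤ s n := kernelMean_resolventKernel_nonneg ha ha0 hx
  have hsm : ∀ n, s n = mean x n + a * mean s n := fun n => by
    rw [← mean_mul, ← mean_add]
    exact (mean_resolvent (fun k => (one_sub_div_pos ha ha0 k).ne') x n).symm
  have h1 := Real.Lp_add_le_of_nonneg (Finset.range N) hpq.lt.le (f := mean x)
    (g := fun n => a * mean s n) (fun n _ => mean_nonneg hx n)
    (fun n _ => mul_nonneg ha0 (mean_nonneg hs0 n))
  simp only [← hsm] at h1
  have h0 : 0 ≤ ∑ n ∈ Finset.range N, s n ^ p :=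
    Finset.sum_nonneg fun n _ => Real.rpow_nonneg (hs0 n) _
  have h2 : (∑ n ∈ Finset.range N, (a * mean s n) ^ p) ^ (1 / p) ≤
      a * q * (∑ n ∈ Finset.range N, s n ^ p) ^ (1 / p) := by
    have e : ∑ n ∈ Finset.range N, (a * mean s n) ^ p =
        a ^ p * ∑ n ∈ Finset.range N, mean s n ^ p := by
      rw [Finset.mul_sum]
      exact Finset.sum_congr rfl fun n _ => Real.mul_rpow ha0 (mean_nonneg hs0 n)
    have e1 : a ^ p * (q ^ p * ∑ n ∈ Finset.range N, s n ^ p) =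
        (a * q) ^ p * ∑ n ∈ Finset.range N, s n ^ p := by
      rw [Real.mul_rpow ha0 (by linarith), mul_assoc]
    have h := mul_le_mul_of_nonneg_left (hardy_sum hpq hs0 N) (Real.rpow_nonneg ha0 p)
    rw [← e, e1] at h
    have h' := Real.rpow_le_rpow (Finset.sum_nonneg fun n _ =>
      Real.rpow_nonneg (mul_nonneg ha0 (mean_nonneg hs0 n)) _) h hpq.one_div_nonneg
    have haq0 : 0 ≤ a * q := mul_nonneg ha0 (by linarith)
    rwa [Real.mul_rpow (Real.rpow_nonneg haq0 _) h0, ← Real.rpow_mul haq0,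
      mul_one_div_cancel hpq.ne_zero, Real.rpow_one] at h'
  rw [inv_mul_eq_div, le_div_iff₀ (by linarith)]
  linarith

theorem kernelMean_tsum_le {p q a : ℝ} (hpq : p.HolderConjugate q) (ha0 : 0 ≤ a)
    (haq : a * q < 1) {x : ℕ → ℝ} (hx : ∀ n, 0 ≤ x n) (hs : Summable fun n => mean x n ^ p) :
    (Summable fun n => kernelMean (resolventKernel a) x n ^ p) ∧
      ∑' n, kernelMean (resolventKernel a) x n ^ p ≤
        ((1 - a * q)⁻¹) ^ p * ∑' n, mean x n ^ p := by
  have hq := hpq.symm.lt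
  have ha : a < 1 := by nlinarith
  have h0 : ∀ n, 0 ≤ kernelMean (resolventKernel a) x n ^ p := fun n =>
    Real.rpow_nonneg (kernelMean_resolventKernel_nonneg ha ha0 hx n) _
  have hm : ∀ n, 0 ≤ mean x n ^ p := fun n => Real.rpow_nonneg (mean_nonneg hx n) _
  have hc : 0 ≤ (1 - a * q)⁻¹ := inv_nonneg.2 (by linarith)
  have hb : ∀ N, ∑ n ∈ Finset.range N, kernelMean (resolventKernel a) x n ^ p ≤
      ((1 - a * q)⁻¹) ^ p * ∑' n, mean x n ^ p := fun N => by
    have h := Real.rpow_le_rpow (Real.rpow_nonneg (Finset.sum_nonneg fun n _ => h0 n) _)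
      (kernelMean_sum_le hpq ha0 haq hx N) hpq.nonneg
    rw [Real.mul_rpow hc (Real.rpow_nonneg (Finset.sum_nonneg fun n _ => hm n) _),
      ← Real.rpow_mul (Finset.sum_nonneg fun n _ => h0 n),
      ← Real.rpow_mul (Finset.sum_nonneg fun n _ => hm n), one_div_mul_cancel hpq.ne_zero,
      Real.rpow_one, Real.rpow_one] at h
    exact h.trans (mul_le_mul_of_nonneg_left (hs.sum_le_tsum _ fun n _ => hm n)
      (Real.rpow_nonneg hc _))
  exact ⟨summable_of_sum_range_le h0 hb, Real.tsum_le_of_sum_range_le h0 hb⟩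

theorem norm_kernelMean_le {h : ℕ → ℕ → ℂ} {g : ℕ → ℕ → ℝ} (hg : ∀ n m, m ≤ n → ‖h n m‖ ≤ g n m)
    (x : ℕ → ℂ) (n : ℕ) : ‖kernelMean h x n‖ ≤ kernelMean g (fun k => ‖x k‖) n := by
  have e : ‖(n : ℂ) + 1‖ = (n : ℝ) + 1 := by
    have := Complex.norm_natCast (n + 1)
    push_cast at this
    exact this
  unfold kernelMean
  rw [norm_div, e]
  refine div_le_div_of_nonneg_right ((norm_sum_le _ _).trans (Finset.sum_le_sum fun m hm => ?_))
    (by positivity)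
  rw [norm_mul]
  exact mul_le_mul_of_nonneg_right (hg n m (Finset.mem_range_succ_iff.1 hm)) (norm_nonneg _)

theorem memCes_kernelMean {p a : ℝ} (hp : 1 < p) (ha0 : 0 ≤ a) (haq : a * (p / (p - 1)) < 1)
    {h : ℕ → ℕ → ℂ} (hh : ∀ n m, m ≤ n → ‖h n m‖ ≤ resolventKernel a n m)
    {x : ℕ → ℂ} (hx : MemCes p x) :
    MemCes p (kernelMean h x) ∧
      cesNorm p (kernelMean h x) ≤
        (p / (p - 1) * (1 - a * (p / (p - 1)))⁻¹) * cesNorm p x := by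
  have hpq : p.HolderConjugate (p / (p - 1)) := Real.HolderConjugate.conjExponent hp
  set q := p / (p - 1)
  have hq := hpq.symm.lt
  have ha : a < 1 := by nlinarith
  have hc : 0 ≤ (1 - a * q)⁻¹ := inv_nonneg.2 (by linarith)
  have hs0 := kernelMean_resolventKernel_nonneg ha ha0 (x := fun k => ‖x k‖) fun _ => norm_nonneg _
  have h1 := kernelMean_tsum_le hpq ha0 haq (fun n => norm_nonneg (x n)) hx
  -- The previous bound lands in `ℓ^p`; a second use of Hardy passes from `ℓ^p` to `ces(p)` and
  -- accounts for the extra factor `q`.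
  have h2 := hardy_tsum hpq hs0 h1.1
  have h3 := MemCes.of_le hp (x := kernelMean h x)
    (fun n => mean_mono (fun k => norm_kernelMean_le hh x k) n) h2.1
  refine ⟨h3.1, h3.2.trans ?_⟩
  have hX : 0 ≤ ∑' n, mean (fun k => ‖x k‖) n ^ p :=
    tsum_nonneg fun n => Real.rpow_nonneg (mean_norm_nonneg x n) _
  have h4 := Real.rpow_le_rpow (tsum_nonneg fun n => Real.rpow_nonneg (mean_nonneg hs0 n) _)
    (h2.2.trans (mul_le_mul_of_nonneg_left h1.2 (Real.rpow_nonneg (by linarith) _)))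
    hpq.one_div_nonneg
  rw [← mul_assoc, ← Real.mul_rpow (by linarith) hc,
    Real.mul_rpow (Real.rpow_nonneg (mul_nonneg (by linarith) hc) _) hX,
    ← Real.rpow_mul (mul_nonneg (by linarith) hc), mul_one_div_cancel hpq.ne_zero,
    Real.rpow_one] at h4
  exact h4

/-! ### Regular operators given by kernels -/

theorem kernelMean_add {𝕜 : Type*} [Field 𝕜] (h : ℕ → ℕ → 𝕜) (x y : ℕ → 𝕜) (n : ℕ) :
    kernelMean h (fun k => x k + y k) n = kernelMean h x n + kernelMean h y n := by
  simp only [kernelMean, mul_add, Finset.sum_add_distrib, add_div]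

theorem kernelMean_mul {𝕜 : Type*} [Field 𝕜] (h : ℕ → ℕ → 𝕜) (c : 𝕜) (x : ℕ → 𝕜) (n : ℕ) :
    kernelMean h (fun k => c * x k) n = c * kernelMean h x n := by
  simp only [kernelMean, mul_left_comm _ c, ← Finset.mul_sum, mul_div_assoc]

section Kernel

variable {p a : ℝ} [hp : Fact (1 < p)]

/-- The bounded operator on `ces(p)` given by a kernel that is dominated by the kernel of the
resolvent at a real point. -/
noncomputable def kernelOperator (ha0 : 0 ≤ a) (haq : a * (p / (p - 1)) < 1) (h : ℕ → ℕ → ℂ)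
    (hh : ∀ n m, m ≤ n → ‖h n m‖ ≤ resolventKernel a n m) : Ces p →L[ℂ] Ces p :=
  LinearMap.mkContinuous
    { toFun := fun x =>
        (⟨kernelMean h x, (memCes_kernelMean hp.out ha0 haq hh x.2).1⟩ : cesSubmodule p)
      map_add' := fun x y => Subtype.ext (funext fun n => kernelMean_add h x y n)
      map_smul' := fun c x => Subtype.ext (funext fun n => kernelMean_mul h c x n) }
    (p / (p - 1) * (1 - a * (p / (p - 1)))⁻¹)
    (fun x => (memCes_kernelMean hp.out ha0 haq hh x.2).2)

theorem kernelOperator_mem_positiveOperators (ha0 : 0 ≤ a) (haq : a * (p / (p - 1)) < 1)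
    (h : ℕ → ℕ → ℂ) (hh : ∀ n m, m ≤ n → ‖h n m‖ ≤ resolventKernel a n m)
    (h0 : ∀ n m, 0 ≤ h n m) : kernelOperator ha0 haq h hh ∈ positiveOperators (Ces p) := by
  intro x hx n
  have hx' : ∀ n, (0 : ℂ) ≤ x n := hx
  change (0 : ℂ) ≤ (∑ m ∈ Finset.range (n + 1), h n m * x m) / ((n : ℂ) + 1)
  exact div_nonneg (Finset.sum_nonneg fun k _ => mul_nonneg (h0 n k) (hx' k))
    (by exact_mod_cast (n + 1).zero_le)

theorem kernelOperator_mem_regularOperators (ha0 : 0 ≤ a) (haq : a * (p / (p - 1)) < 1)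
    (h : ℕ → ℕ → ℂ) (hh : ∀ n m, m ≤ n → ‖h n m‖ ≤ resolventKernel a n m) :
    kernelOperator ha0 haq h hh ∈ regularOperators (Ces p) := by
  -- Positive and negative parts of the real and imaginary parts of `h` are dominated by `‖h‖`, so
  -- each is the kernel of a bounded positive operator.
  have key : ∀ f : ℂ → ℝ, (∀ w, |f w| ≤ ‖w‖) → ∃ T ∈ regularOperators (Ces p), ∀ (x : Ces p) n,
      T x n = kernelMean (fun n m => ((max (f (h n m)) 0 : ℝ) : ℂ)) x n := fun f hf =>
    ⟨kernelOperator ha0 haq (fun n m => ((max (f (h n m)) 0 : ℝ) : ℂ)) fun n m hmn => by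
        rw [Complex.norm_real, Real.norm_of_nonneg (le_max_right _ _)]
        exact (max_le ((le_abs_self _).trans (hf _)) (norm_nonneg _)).trans (hh n m hmn),
      Submodule.subset_span (kernelOperator_mem_positiveOperators ha0 haq _ _ fun n m =>
        Complex.zero_le_real.2 (le_max_right _ _)), fun x n => rfl⟩
  obtain ⟨A, hA, hA'⟩ := key Complex.re Complex.abs_re_le_norm
  obtain ⟨B, hB, hB'⟩ := key (fun w => -w.re) fun w => by
    rw [abs_neg]; exact Complex.abs_re_le_norm w
  obtain ⟨D, hD, hD'⟩ := key Complex.im Complex.abs_im_le_norm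
  obtain ⟨E, hE, hE'⟩ := key (fun w => -w.im) fun w => by
    rw [abs_neg]; exact Complex.abs_im_le_norm w
  have e : kernelOperator ha0 haq h hh = A - B + Complex.I • (D - E) := by
    refine ContinuousLinearMap.ext fun x => Subtype.ext (funext fun n => ?_)
    change kernelMean h x n = A x n - B x n + Complex.I * (D x n - E x n)
    rw [hA', hB', hD', hE']
    simp only [kernelMean, ← sub_div, ← Finset.sum_sub_distrib, ← mul_div_assoc, Finset.mul_sum,
      ← add_div, ← Finset.sum_add_distrib]
    congr 1
    refine Finset.sum_congr rfl fun m _ => ?_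
    have hmax : ∀ t : ℝ, max t 0 - max (-t) 0 = t := fun t => max_zero_sub_max_neg_zero_eq_self t
    have h1 := congrArg ((↑) : ℝ → ℂ) (hmax (h n m).re)
    have h2 := congrArg ((↑) : ℝ → ℂ) (hmax (h n m).im)
    rw [Complex.ofReal_sub] at h1 h2
    conv_lhs => rw [← Complex.re_add_im (h n m), ← h1, ← h2]
    ring
  rw [e]
  exact add_mem (sub_mem hA hB) (Subalgebra.smul_mem _ (sub_mem hD hE) _)

end Kernel

/-! ### Points outside the disc -/

theorem isUnit_of_inv_re_lt {p : ℝ} [hp : Fact (1 < p)] {z : ℂ} (hz0 : z ≠ 0)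
    (hz : z⁻¹.re * (p / (p - 1)) < 1) :
    IsUnit (algebraMap ℂ (regularOperators (Ces p)) z - regularCesaroOperator p) := by
  have hpq : p.HolderConjugate (p / (p - 1)) := Real.HolderConjugate.conjExponent hp.out
  set q := p / (p - 1) with hq'
  have hq := hpq.symm.lt
  set w := z⁻¹ with hw
  obtain ⟨a, ha0, hwa, haq⟩ : ∃ a : ℝ, 0 ≤ a ∧ w.re ≤ a ∧ a * q < 1 := by
    refine ⟨max w.re 0, le_max_right _ _, le_max_left _ _, ?_⟩
    rcases max_cases w.re 0 with ⟨h, _⟩ | ⟨h, _⟩ <;> rw [h] <;> linarith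
  have ha : a < 1 := by nlinarith
  have hne : ∀ k : ℕ, 1 - w / ((k : ℂ) + 1) ≠ 0 := fun k =>
    norm_pos_iff.1 ((one_sub_div_pos ha ha0 k).trans_le (one_sub_div_le_norm hwa k))
  have hdom : ∀ n m, m ≤ n → ‖resolventKernel w n m‖ ≤ resolventKernel a n m := fun n m hmn =>
    norm_resolventKernel_le ha ha0 hwa hmn
  set K : regularOperators (Ces p) :=
    ⟨kernelOperator ha0 haq (resolventKernel w) hdom,
      kernelOperator_mem_regularOperators ha0 haq _ hdom⟩ with hK
  -- Since `z - C = z (1 - w C)`, the candidate inverse is `w (1 + w K)`.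
  set R : regularOperators (Ces p) := w • (1 + w • K) with hR
  have hzw : z * w = 1 := mul_inv_cancel₀ hz0
  have hRx : ∀ (x : Ces p) n, (R : Ces p →L[ℂ] Ces p) x n =
    w * (x n + w * kernelMean (resolventKernel w) x n) := fun x n => rfl
  set S := algebraMap ℂ (regularOperators (Ces p)) z - regularCesaroOperator p with hS
  have hSx : ∀ (x : Ces p) n, (S : Ces p →L[ℂ] Ces p) x n = z * x n - mean x n := fun x n => rfl
  have h1 : S * R = 1 := by
    refine Subtype.ext (ContinuousLinearMap.ext fun x => Subtype.ext (funext fun n => ?_))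
    change (S : Ces p →L[ℂ] Ces p) ((R : Ces p →L[ℂ] Ces p) x) n = x n
    have e : (((R : Ces p →L[ℂ] Ces p) x : Ces p) : ℕ → ℂ) =
      fun n => w * (x n + w * kernelMean (resolventKernel w) x n) := funext (hRx x)
    rw [hSx, e, mean_mul, mean_resolvent hne]
    linear_combination (x n + w * kernelMean (resolventKernel w) x n) * hzw
  have h2 : R * S = 1 := by
    refine Subtype.ext (ContinuousLinearMap.ext fun x => Subtype.ext (funext fun n => ?_))
    change (R : Ces p →L[ℂ] Ces p) ((S : Ces p →L[ℂ] Ces p) x) n = x n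
    have e : (((S : Ces p →L[ℂ] Ces p) x : Ces p) : ℕ → ℂ) =
        fun n => z * (x n - w * mean x n) := funext fun n => by
      rw [hSx]
      linear_combination mean x n * hzw
    rw [hRx, e, kernelMean_mul, kernelMean_resolventKernel_sub hne]
    linear_combination (x n - w * mean x n + w * mean x n) * hzw
  exact ⟨⟨S, R, h1, h2⟩, rfl⟩

theorem inv_re_mul_lt_one_iff {z : ℂ} (hz : z ≠ 0) {q : ℝ} (hq : 0 < q) :
    z⁻¹.re * q < 1 ↔ q / 2 < ‖z - ((q / 2 : ℝ) : ℂ)‖ := by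
  have h := Complex.normSq_pos.2 hz
  rw [Complex.inv_re, div_mul_eq_mul_div, div_lt_one h, ← sq_lt_sq₀ (by linarith) (norm_nonneg _),
    ← Complex.normSq_eq_norm_sq, Complex.normSq_apply, Complex.normSq_apply]
  simp only [Complex.sub_re, Complex.sub_im, Complex.ofReal_re, Complex.ofReal_im]
  constructor <;> intro h <;> nlinarith

/-! ### Eigenfunctionals of the Cesàro operator -/

theorem one_lt_inv_re_mul_iff {z : ℂ} (hz : z ≠ 0) {q : ℝ} (hq : 0 < q) :
    1 < z⁻¹.re * q ↔ ‖z - ((q / 2 : ℝ) : ℂ)‖ < q / 2 := by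
  have h := Complex.normSq_pos.2 hz
  rw [Complex.inv_re, div_mul_eq_mul_div, one_lt_div h, ← sq_lt_sq₀ (norm_nonneg _) (by linarith),
    ← Complex.normSq_eq_norm_sq, Complex.normSq_apply, Complex.normSq_apply]
  simp only [Complex.sub_re, Complex.sub_im, Complex.ofReal_re, Complex.ofReal_im]
  constructor <;> intro h <;> nlinarith

/-- Expanding the square gives `‖1 - z/t‖² ≤ 1 - 2a/t ≤ exp (-2a/t)`, while `exp (-1/t) ≤ t/(t +
1)`. The bound has this form so that it telescopes against powers `t ^ a`. -/
theorem norm_one_sub_div_le {a : ℝ} {z : ℂ} (ha : 0 ≤ a) {t : ℝ} (ht : 0 < t)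
    (hzt : ‖z‖ ^ 2 ≤ 2 * (z.re - a) * t) : ‖1 - z / (t : ℂ)‖ ≤ (t / (t + 1)) ^ a := by
  have h1 : ‖1 - z / (t : ℂ)‖ ^ 2 ≤ 1 - 2 * a / t := by
    rw [← Complex.normSq_eq_norm_sq, Complex.normSq_apply]
    rw [← Complex.normSq_eq_norm_sq, Complex.normSq_apply] at hzt
    simp only [Complex.sub_re, Complex.sub_im, Complex.one_re, Complex.one_im,
      Complex.div_ofReal_re, Complex.div_ofReal_im]
    have e : 1 - 2 * a / t - ((1 - z.re / t) * (1 - z.re / t) + (0 - z.im / t) * (0 - z.im / t)) =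
        (2 * (z.re - a) * t - (z.re * z.re + z.im * z.im)) / t ^ 2 := by
      field_simp
      ring
    have : 0 ≤ (2 * (z.re - a) * t - (z.re * z.re + z.im * z.im)) / t ^ 2 :=
      div_nonneg (by linarith) (by positivity)
    linarith
  have h2 : 1 - 2 * a / t ≤ Real.exp (-(a / t)) ^ 2 := by
    have := Real.add_one_le_exp (-(2 * a / t))
    rw [← Real.exp_nat_mul]
    have e : ((2 : ℕ) : ℝ) * -(a / t) = -(2 * a / t) := by push_cast; ring
    rw [e]
    linarith
  have h3 : ‖1 - z / (t : ℂ)‖ ≤ Real.exp (-(a / t)) :=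
    (sq_le_sq₀ (norm_nonneg _) (Real.exp_pos _).le).1 (h1.trans h2)
  have h4 : Real.exp (-(1 / t)) ≤ t / (t + 1) := by
    rw [Real.exp_neg, inv_le_comm₀ (Real.exp_pos _) (by positivity), inv_div]
    have := Real.add_one_le_exp (1 / t)
    have e : (t + 1) / t = 1 / t + 1 := by rw [add_div, div_self ht.ne', add_comm]
    rwa [e]
  have h5 := Real.rpow_le_rpow (Real.exp_pos _).le h4 ha
  rw [← Real.exp_mul] at h5
  have e : -(1 / t) * a = -(a / t) := by ring
  rw [e] at h5
  exact h3.trans h5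

/-- The partial products belong to `ℓ^q` if the real part of `z` is greater than `1 / q`. -/
theorem summable_norm_cesProd {z : ℂ} {q : ℝ} (hq : 0 < q) (hz : 1 < z.re * q) :
    Summable fun n => ‖cesProd z n‖ ^ q := by
  -- The gap `a < Re z` absorbs the quadratic error for `n ≥ N`, and `a q > 1` makes the comparison
  -- series converge.
  obtain ⟨a, h1a, haz⟩ := exists_between (show 1 / q < z.re by rwa [div_lt_iff₀ hq])
  have ha : 0 < a := lt_trans (by positivity) h1a
  obtain ⟨N, hN⟩ := exists_nat_ge (‖z‖ ^ 2 / (2 * (z.re - a)))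
  rw [div_le_iff₀ (by linarith)] at hN
  -- Beyond `N` the quantity `‖cesProd z n‖ (n + 1)^a` does not increase, so the products are
  -- `O(n^(-a))`.
  have hstep : ∀ n, N ≤ n →
      ‖cesProd z (n + 1)‖ * ((n + 1 : ℕ) + 1 : ℝ) ^ a ≤ ‖cesProd z n‖ * ((n : ℝ) + 1) ^ a := by
    intro n hn
    have hn' : (N : ℝ) ≤ n := by exact_mod_cast hn
    have h := norm_one_sub_div_le (a := a) (z := z) ha.le (t := (n : ℝ) + 1) (by positivity)
      (hN.trans (by nlinarith))
    push_cast at h ⊢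
    rw [cesProd_succ, norm_mul, mul_assoc]
    refine mul_le_mul_of_nonneg_left ?_ (norm_nonneg _)
    refine (mul_le_mul_of_nonneg_right h (by positivity)).trans_eq ?_
    rw [← Real.mul_rpow (by positivity) (by positivity), div_mul_cancel₀ _ (by positivity)]
  have hbd : ∀ n, N ≤ n →
      ‖cesProd z n‖ * ((n : ℝ) + 1) ^ a ≤ ‖cesProd z N‖ * ((N : ℝ) + 1) ^ a := by
    intro n hn
    induction n, hn using Nat.le_induction with
    | base => exact le_rfl
    | succ n hn ih => exact (hstep n hn).trans ih
  set K := ‖cesProd z N‖ * ((N : ℝ) + 1) ^ a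
  have hs : Summable fun n : ℕ => K ^ q * ((n : ℝ) + 1) ^ (-(a * q)) := by
    have h := (summable_nat_add_iff 1).2
      (Real.summable_nat_rpow.2 (by rw [div_lt_iff₀ hq] at h1a; linarith : -(a * q) < -1))
    push_cast at h
    exact h.mul_left _
  refine Summable.of_norm_bounded_eventually_nat hs
    (Filter.eventually_atTop.2 ⟨N, fun n hn => ?_⟩)
  rw [Real.norm_of_nonneg (Real.rpow_nonneg (norm_nonneg _) _)]
  have hn1 : (0 : ℝ) < ((n : ℝ) + 1) ^ a := by positivity
  have h := (le_div_iff₀ hn1).2 (hbd n hn)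
  refine (Real.rpow_le_rpow (norm_nonneg _) h hq.le).trans_eq ?_
  rw [Real.div_rpow (by positivity) hn1.le, ← Real.rpow_mul (by positivity),
    Real.rpow_neg (by positivity), div_eq_mul_inv]

/-- Summation by parts, from `cesProd z n - cesProd z (n + 1) = z * cesProd z n / (n + 1)`. -/
theorem sum_cesProd_mul_mean {z μ : ℂ} (hμ : μ * z = 1) (y : ℕ → ℂ) (N : ℕ) :
    ∑ n ∈ Finset.range N, cesProd z n * mean y n =
      μ * (∑ n ∈ Finset.range N, cesProd z n * y n -
        cesProd z N * ∑ n ∈ Finset.range N, y n) := by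
  induction N with
  | zero => simp
  | succ N ih =>
    rw [Finset.sum_range_succ, ih, Finset.sum_range_succ (fun n => cesProd z n * y n), mean,
      cesProd_succ, Finset.sum_range_succ y]
    have h : ((N : ℂ) + 1) ≠ 0 := by exact_mod_cast N.succ_ne_zero
    field_simp
    linear_combination (-cesProd z N * (∑ n ∈ Finset.range N, y n + y N)) * hμ

/-- A nonzero limit would bound `‖f n‖` below by a multiple of the harmonic series. -/
theorem eq_zero_of_tendsto_natCast_mul {f : ℕ → ℂ} (hf : Summable f) {L : ℂ}
    (hL : Filter.Tendsto (fun n : ℕ => ((n : ℂ) + 1) * f n) Filter.atTop (nhds L)) : L = 0 := by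
  by_contra h
  have hpos := norm_pos_iff.2 h
  have hev := hL.norm.eventually (lt_mem_nhds (half_lt_self hpos))
  have hnot : ¬ Summable fun n : ℕ => 1 / ((n : ℝ) + 1) := fun hs =>
    Real.not_summable_one_div_natCast ((summable_nat_add_iff 1).1 (by push_cast; exact hs))
  refine hnot (Summable.of_norm_bounded_eventually_nat (hf.norm.mul_left (2 / ‖L‖)) ?_)
  filter_upwards [hev] with n hn
  have e : ‖(n : ℂ) + 1‖ = (n : ℝ) + 1 := by
    have := Complex.norm_natCast (n + 1)
    push_cast at this
    exact this
  have hn1 : (0 : ℝ) < (n : ℝ) + 1 := by positivity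
  rw [norm_mul, e] at hn
  rw [Real.norm_of_nonneg (by positivity), div_mul_eq_mul_div, div_le_div_iff₀ hn1 hpos]
  linarith

/-- The boundary term of the summation by parts has to vanish. Up to a null sequence it is `N + 1`
times a summable term, and it converges because the other terms do, so its limit is `0`. -/
theorem tsum_cesProd_mul_mean {z μ : ℂ} (hμ : μ * z = 1) {y : ℕ → ℂ}
    (h1 : Summable fun n => cesProd z n * y n) (h2 : Summable fun n => cesProd z n * mean y n) :
    ∑' n, cesProd z n * mean y n = μ * ∑' n, cesProd z n * y n := by
  have hb : ∀ N : ℕ, ((N : ℂ) + 1) * (cesProd z N * mean y N) =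
      ∑ n ∈ Finset.range N, cesProd z n * y n -
        z * ∑ n ∈ Finset.range N, cesProd z n * mean y n + cesProd z N * y N := fun N => by
    rw [sum_cesProd_mul_mean hμ, mean, Finset.sum_range_succ y]
    have h : ((N : ℂ) + 1) ≠ 0 := by exact_mod_cast N.succ_ne_zero
    field_simp
    linear_combination (∑ n ∈ Finset.range N, cesProd z n * y n -
        cesProd z N * ∑ n ∈ Finset.range N, y n) * hμ
  have hL := ((h1.hasSum.tendsto_sum_nat.sub (h2.hasSum.tendsto_sum_nat.const_mul z)).add
    h1.tendsto_atTop_zero)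
  simp only [← hb, add_zero] at hL
  linear_combination (-μ) * eq_zero_of_tendsto_natCast_mul h2 hL -
    (∑' n, cesProd z n * mean y n) * hμ

section Functional

variable {p : ℝ}

theorem summable_cesProd_mul_mean (hp : 1 < p) {z : ℂ} (hz : 1 < z.re * (p / (p - 1)))
    {x : ℕ → ℂ} (hx : MemCes p x) :
    (Summable fun n => ‖cesProd z n * mean x n‖) ∧
      ∑' n, ‖cesProd z n * mean x n‖ ≤
        (∑' n, ‖cesProd z n‖ ^ (p / (p - 1))) ^ (1 / (p / (p - 1))) * cesNorm p x := by
  have hpq : p.HolderConjugate (p / (p - 1)) := Real.HolderConjugate.conjExponent hp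
  have hH := Real.summable_and_inner_le_Lp_mul_Lq_tsum_of_nonneg hpq.symm
    (fun n => norm_nonneg (cesProd z n)) (mean_norm_nonneg x)
    (summable_norm_cesProd hpq.symm.pos hz) hx
  have hle : ∀ n, ‖cesProd z n * mean x n‖ ≤ ‖cesProd z n‖ * mean (fun k => ‖x k‖) n := fun n => by
    rw [norm_mul]
    exact mul_le_mul_of_nonneg_left (norm_mean_le x n) (norm_nonneg _)
  have hs := Summable.of_nonneg_of_le (fun n => norm_nonneg _) hle hH.1
  exact ⟨hs, (Summable.tsum_le_tsum hle hs hH.1).trans hH.2⟩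

variable [hp : Fact (1 < p)]

/-- Averaging maps `ces(p)` into `ℓ^p`, so pairing the averages with `cesProd μ⁻¹` in `ℓ^q` is
bounded by Hölder. -/
theorem exists_eigenfunctional {μ : ℂ} (hμ0 : μ ≠ 0) (hμ : 1 < μ⁻¹.re * (p / (p - 1))) :
    ∃ φ : Ces p →L[ℂ] ℂ, φ ≠ 0 ∧ ∀ x, φ (cesaroOperator p x) = μ * φ x := by
  have hs := fun x : Ces p => (summable_cesProd_mul_mean hp.out hμ x.2)
  set z := μ⁻¹
  let φ : Ces p →L[ℂ] ℂ := LinearMap.mkContinuous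
    { toFun := fun x => ∑' n, cesProd z n * mean (x : ℕ → ℂ) n
      map_add' := fun x y => by
        rw [← (hs x).1.of_norm.tsum_add (hs y).1.of_norm]
        refine tsum_congr fun n => ?_
        rw [← mul_add, ← mean_add]
        rfl
      map_smul' := fun c x => by
        rw [RingHom.id_apply, smul_eq_mul, ← tsum_mul_left]
        refine tsum_congr fun n => ?_
        exact (congrArg (cesProd z n * ·) (mean_mul c x n)).trans (mul_left_comm _ _ _) }
    _ (fun x => (norm_tsum_le_tsum_norm (hs x).1).trans (hs x).2)
  have hφ : ∀ x, φ x = ∑' n, cesProd z n * mean (x : ℕ → ℂ) n := fun x => rfl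
  refine ⟨φ, fun h0 => ?_, fun x => ?_⟩
  -- The averages of `v = e₀ - e₁` are exactly `e₀`, hence `φ v = 1`.
  · set v : ℕ → ℂ := fun n => if n = 0 then 1 else if n = 1 then -1 else 0 with hv
    have hsum : ∀ n, ∑ k ∈ Finset.range (n + 1), v k = if n = 0 then 1 else 0 := fun n => by
      induction n with
      | zero => simp [hv]
      | succ n ih =>
        rw [Finset.sum_range_succ, ih]
        rcases n with _ | n <;> simp [hv]
    have hnorm : ∀ n, ∑ k ∈ Finset.range (n + 1), ‖v k‖ ≤ 2 := fun n => by
      have : ∑ k ∈ Finset.range (n + 1), ‖v k‖ = if n = 0 then 1 else 2 := by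
        induction n with
        | zero => simp [hv]
        | succ n ih =>
          rw [Finset.sum_range_succ, ih]
          rcases n with _ | n <;> simp [hv]
          norm_num
      rw [this]
      split_ifs <;> norm_num
    have hmem : MemCes p v := by
      refine (MemCes.of_le hp.out (b := fun n => 2 * ((n : ℝ) + 1)⁻¹) (fun n => ?_) ?_).1
      · exact div_le_div_of_nonneg_right (hnorm n) (by positivity)
      · have h := (summable_nat_add_iff 1).2 (Real.summable_nat_rpow.2 (neg_lt_neg hp.out))
        push_cast at h
        refine (h.mul_left (2 ^ p)).congr fun n => ?_
        rw [Real.mul_rpow (by norm_num) (by positivity), Real.inv_rpow (by positivity),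
          Real.rpow_neg (by positivity)]
    have h1 := hφ (⟨v, hmem⟩ : cesSubmodule p)
    rw [h0, tsum_eq_single 0 fun n hn => ?_] at h1
    · simp [cesProd, mean, hv] at h1
      exact zero_ne_one h1
    · change cesProd z n * (_ / _) = 0
      rw [hsum, if_neg hn, zero_div, mul_zero]
  · have h2 := (hs (cesaroOperator p x)).1.of_norm
    exact tsum_cesProd_mul_mean (mul_inv_cancel₀ hμ0) (hs x).1.of_norm h2

/-! ### Points of the disc -/

theorem mem_spectrum_of_norm_le {z : ℂ}
    (hz : ‖z - ((p / (p - 1) / 2 : ℝ) : ℂ)‖ ≤ p / (p - 1) / 2) :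
    z ∈ spectrum ℂ (cesaroOperator p) := by
  have hpq : p.HolderConjugate (p / (p - 1)) := Real.HolderConjugate.conjExponent hp.out
  set q := p / (p - 1) with hq'
  have hq := hpq.symm.pos
  rintro ⟨⟨S, R, hSR, -⟩, hS : S = _⟩
  set d : ℂ := z - ((q / 2 : ℝ) : ℂ) with hd
  -- This choice gives `0 < t ≤ 1` and `t ‖d‖ ‖R‖ < 1`: moving `z` towards the centre by the
  -- fraction `t` enters the open disc, yet stays closer to `z` than `1/‖R‖`.
  set t : ℝ := (1 + ‖d‖ * ‖R‖)⁻¹ with ht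
  have hden : 0 < 1 + ‖d‖ * ‖R‖ := by positivity
  have ht0 : 0 < t := inv_pos.2 hden
  have ht1 : t ≤ 1 := inv_le_one_of_one_le₀ (by
    linarith [mul_nonneg (norm_nonneg d) (norm_nonneg R)])
  have htR : t * (‖d‖ * ‖R‖) < 1 := by
    rw [ht, inv_mul_lt_iff₀ hden]
    linarith
  set μ : ℂ := z - t * d with hμ
  have hμd : ‖μ - ((q / 2 : ℝ) : ℂ)‖ < q / 2 := by
    have e : μ - ((q / 2 : ℝ) : ℂ) = ((1 - t : ℝ) : ℂ) * d := by
      rw [hμ, hd]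
      push_cast
      ring
    rw [e, norm_mul, Complex.norm_real, Real.norm_of_nonneg (by linarith)]
    nlinarith [norm_nonneg d]
  have hμ0 : μ ≠ 0 := fun h => by
    rw [h, zero_sub, norm_neg, Complex.norm_real, Real.norm_of_nonneg (by linarith)] at hμd
    exact lt_irrefl _ hμd
  obtain ⟨φ, hφ0, hφ⟩ := exists_eigenfunctional hμ0 ((one_lt_inv_re_mul_iff hμ0 hq).2 hμd)
  -- Evaluate `φ ∘ (z - C) = (z - μ) φ` at `R x`, where `z - μ = t d`.
  have hφR : φ = (t * d) • φ.comp R := by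
    refine ContinuousLinearMap.ext fun x => ?_
    have h1 : S (R x) = x := congrArg (fun T : Ces p →L[ℂ] Ces p => T x) hSR
    have h2 : φ (S (R x)) = z * φ (R x) - μ * φ (R x) := by
      rw [hS, ← hφ, ← smul_eq_mul, ← map_smul, ← map_sub]
      rfl
    rw [h1] at h2
    rw [h2, hμ]
    change _ = t * d * φ (R x)
    ring
  have hle : ‖φ‖ ≤ t * (‖d‖ * ‖R‖) * ‖φ‖ := by
    calc ‖φ‖ = ‖((t : ℂ) * d) • φ.comp R‖ := congrArg _ hφR
      _ = t * ‖d‖ * ‖φ.comp R‖ := by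
        rw [norm_smul, norm_mul, Complex.norm_real, Real.norm_of_nonneg ht0.le]
      _ ≤ t * ‖d‖ * (‖φ‖ * ‖R‖) :=
        mul_le_mul_of_nonneg_left (φ.opNorm_comp_le R) (by positivity)
      _ = t * (‖d‖ * ‖R‖) * ‖φ‖ := by ring
  nlinarith [norm_pos_iff.2 hφ0]

theorem spectrum_subset_orderSpectrum :
    spectrum ℂ (cesaroOperator p) ⊆ orderSpectrum (regularCesaroOperator p) := by
  intro z hz hu
  exact hz (hu.map (regularOperators (Ces p)).val)

theorem orderSpectrum_subset_disc {z : ℂ} (hz : z ∈ orderSpectrum (regularCesaroOperator p)) :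
    ‖z - ((p / (p - 1) / 2 : ℝ) : ℂ)‖ ≤ p / (p - 1) / 2 := by
  have hq := (Real.HolderConjugate.conjExponent hp.out).symm.pos
  by_contra! h
  have hz0 : z ≠ 0 := fun h0 => by
    rw [h0, zero_sub, norm_neg, Complex.norm_real, Real.norm_of_nonneg] at h
    · exact lt_irrefl _ h
    · exact (half_pos hq).le
  exact hz (isUnit_of_inv_re_lt hz0 ((inv_re_mul_lt_one_iff hz0 hq).2 h))

end Functional

end CesaroSpace

theorem proposition5p1 (p : ℝ) [Fact (1 < p)] :
    CesaroSpace.orderSpectrum (CesaroSpace.regularCesaroOperator p) =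
        spectrum ℂ (CesaroSpace.cesaroOperator p) ∧
      spectrum ℂ (CesaroSpace.cesaroOperator p) =
        {z : ℂ | ‖z - ((p / (p - 1) / 2 : ℝ) : ℂ)‖ ≤ p / (p - 1) / 2} :=
  ⟨Set.Subset.antisymm
      (fun _ hz => CesaroSpace.mem_spectrum_of_norm_le (CesaroSpace.orderSpectrum_subset_disc hz))
      CesaroSpace.spectrum_subset_orderSpectrum,
    Set.Subset.antisymm
      (fun _ hz => CesaroSpace.orderSpectrum_subset_disc
        (CesaroSpace.spectrum_subset_orderSpectrum hz))
      (fun _ hz => CesaroSpace.mem_spectrum_of_norm_le hz)⟩
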